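/- Let $A$ be a qutrit observable, i.e. a self-adjoint operator on $\mathbb{C}^3$, with eigenvalues $a_1<a_2<a_3$, and let $V_3(a)=(a_2-a_1)(a_3-a_1)(a_3-a_2)$. Let $\psi$ be a Haar-distributed random pure state, i.e. a random unit vector of $\mathbb{C}^3$ distributed according to the uniform (normalized surface) probability measure on the unit sphere of $\mathbb{C}^3\cong\mathbb{R}^6$. Write $\langle A\rangle_\psi=\langle\psi|A|\psi\rangle$, $\langle A^2\rangle_\psi=\langle\psi|A^2|\psi\rangle$ and $\Delta_\psi A=\sqrt{\langle A^2\rangle_\psi-\langle A\rangle_\psi^2}$. Densities are with respect to Lebesgue measure. (i) The pair $(\langle A\rangle_\psi,\langle A^2\rangle_\psi)$ has the joint probability density $$f_{\langle A\rangle,\langle A^2\rangle}(r,s)=\frac{2}{V_3(a)}\quad\text{for }(r,s)\in D_1\cup D_2,$$ and $0$ otherwise, where $$D_1=\{(r,s): a_1\le r\le a_2,\ (a_1+a_2)r-a_1a_2\le s\le (a_1+a_3)r-a_1a_3\},$$ $$D_2=\{(r,s): a_2\le r\le a_3,\ (a_2+a_3)r-a_2a_3\le s\le (a_1+a_3)r-a_1a_3\}.$$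 (ii) The pair $(\langle A\rangle_\psi,\Delta_\psi A)$ has the joint probability density $$f_{\langle A\rangle,\Delta A}(r,x)=\frac{4x}{V_3(a)}\quad\text{for }(r,x)\in R_1\cup R_2,$$ and $0$ otherwise, where $$R_1=\{(r,x): a_1\le r\le a_2,\ \sqrt{(a_2-r)(r-a_1)}\le x\le\sqrt{(a_3-r)(r-a_1)}\},$$ $$R_2=\{(r,x): a_2\le r\le a_3,\ \sqrt{(a_3-r)(r-a_2)}\le x\le\sqrt{(a_3-r)(r-a_1)}\}.$$ (iii) The uncertainty $\Delta_\psi A$ has the probability density $$f_{\Delta A}(x)=\frac{8}{V_3(a)}\,x\left(\chi_{[0,\frac{a_3-a_1}{2}]}(x)\,\varepsilon_{31}(x)-\chi_{[0,\frac{a_3-a_2}{2}]}(x)\,\varepsilon_{32}(x)-\chi_{[0,\frac{a_2-a_1}{2}]}(x)\,\varepsilon_{21}(x)\right)$$ for $x\in[0,\frac{a_3-a_1}{2}]$, and $0$ otherwise, where $\chi_S$ is the indicator function of the set $S$ and $\varepsilon_{ij}(x)=\sqrt{\left(\frac{a_i-a_j}{2}\right)^2-x^2}$ (each product $\chi_S\,\varepsilon_{ij}$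 being $0$ outside $S$). -/

import Mathlib

open MeasureTheory

noncomputable section

/-- The Hilbert space `ℂ^d` with its standard Hermitian inner product. -/
abbrev QuditSpace (d : ℕ) : Type := EuclideanSpace ℂ (Fin d)

/-- The pure states of a `d`-level system: the unit vectors of `ℂ^d`. -/
abbrev PureState (d : ℕ) : Type := Metric.sphere (0 : QuditSpace d) 1

/-- The uniform (Haar) probability measure on the unit sphere of `ℂ^d`: the surface measure
induced by Lebesgue measure `∏ₖ dxₖ dyₖ` of `ℂ^d ≅ ℝ^{2d}`, divided by its total mass. -/
def haarState (d : ℕ) : Measure (PureState d) :=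
  ((volume : Measure (QuditSpace d)).toSphere Set.univ)⁻¹ •
    (volume : Measure (QuditSpace d)).toSphere

instance haarState_isProbabilityMeasure (d : ℕ) [NeZero d] :
    IsProbabilityMeasure (haarState d) := by
  constructor
  rw [haarState, Measure.smul_apply, smul_eq_mul]
  refine ENNReal.inv_mul_cancel ?_ (measure_ne_top _ _)
  rw [Ne, Measure.measure_univ_eq_zero, Measure.toSphere_eq_zero_iff_finrank]
  exact Module.finrank_pos.ne'

/-- The expectation value `⟨ψ|A|ψ⟩` (real when `A` is self-adjoint). -/
def expectation {d : ℕ} (A : QuditSpace d →ₗ[ℂ] QuditSpace d) (ψ : PureState d) : ℝ :=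
  (inner ℂ (ψ : QuditSpace d) (A (ψ : QuditSpace d))).re

/-- The uncertainty (standard deviation) `Δ_ψ A = √(⟨ψ|A²|ψ⟩ - ⟨ψ|A|ψ⟩²)`. -/
def uncertainty {d : ℕ} (A : QuditSpace d →ₗ[ℂ] QuditSpace d) (ψ : PureState d) : ℝ :=
  Real.sqrt (expectation (A ^ 2) ψ - expectation A ψ ^ 2)

/-- The random variable `X` on `(Ω, P)` has the probability density function `f`
with respect to Lebesgue measure. -/
def HasDensity {Ω E : Type*} [MeasurableSpace Ω] [MeasureSpace E]
    (X : Ω → E) (P : Measure Ω) (f : E → ℝ) : Prop :=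
  AEMeasurable X P ∧ Measurable f ∧ (∀ x, 0 ≤ f x) ∧
    P.map X = (volume : Measure E).withDensity (fun x => ENNReal.ofReal (f x))

/-- The Vandermonde product `(a₂ - a₁)(a₃ - a₁)(a₃ - a₂)`. -/
def V3 (a₁ a₂ a₃ : ℝ) : ℝ := (a₂ - a₁) * (a₃ - a₁) * (a₃ - a₂)

def regionD₁ (a₁ a₂ a₃ : ℝ) : Set (ℝ × ℝ) :=
  {p | a₁ ≤ p.1 ∧ p.1 ≤ a₂ ∧
    (a₁ + a₂) * p.1 - a₁ * a₂ ≤ p.2 ∧ p.2 ≤ (a₁ + a₃) * p.1 - a₁ * a₃}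

def regionD₂ (a₁ a₂ a₃ : ℝ) : Set (ℝ × ℝ) :=
  {p | a₂ ≤ p.1 ∧ p.1 ≤ a₃ ∧
    (a₂ + a₃) * p.1 - a₂ * a₃ ≤ p.2 ∧ p.2 ≤ (a₁ + a₃) * p.1 - a₁ * a₃}

def regionR₁ (a₁ a₂ a₃ : ℝ) : Set (ℝ × ℝ) :=
  {p | a₁ ≤ p.1 ∧ p.1 ≤ a₂ ∧
    Real.sqrt ((a₂ - p.1) * (p.1 - a₁)) ≤ p.2 ∧ p.2 ≤ Real.sqrt ((a₃ - p.1) * (p.1 - a₁))}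

def regionR₂ (a₁ a₂ a₃ : ℝ) : Set (ℝ × ℝ) :=
  {p | a₂ ≤ p.1 ∧ p.1 ≤ a₃ ∧
    Real.sqrt ((a₃ - p.1) * (p.1 - a₂)) ≤ p.2 ∧ p.2 ≤ Real.sqrt ((a₃ - p.1) * (p.1 - a₁))}

/-- For eigenvalues `b ≤ a`: the function `χ_{[0,(a-b)/2]}(x) · √(((a-b)/2)² - x²)`. -/
def chiEps (a b : ℝ) : ℝ → ℝ :=
  Set.indicator (Set.Icc 0 ((a - b) / 2)) (fun x => Real.sqrt (((a - b) / 2) ^ 2 - x ^ 2))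

end

/-! In an eigenbasis of `A` only the weights `pᵢ = |⟨bᵢ|ψ⟩|²` matter, and they are uniform on the
probability simplex: `π|z|²` carries area on `ℂ` to length on `[0, ∞)`
(`map_pi_mul_norm_sq_volume`). The moments `(∑ aᵢpᵢ, ∑ aᵢ²pᵢ)` are an affine image of the weights,
hence uniform on the triangle with vertices `(aᵢ, aᵢ²)`, whose area is `V3 / 2`.

To avoid surface integrals, a set of states is replaced by its cone in the unit ball. The cone goes
to the orthant of `ℝ³` and then through a Vandermonde matrix of determinant `V3`, where its volume
is elementary (`volume_simplexCone`, `haarState_three_preimage`).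

The substitution `s = r² + x²`, with Jacobian `2x`, gives (ii). Integrating out `r` gives (iii): a
slice at height `x` is an interval minus two disjoint subintervals, with lengths `2ε₃₁`, `2ε₃₂`,
`2ε₂₁` (`chiEps_add_le_and_volume_slice`). -/

/-! ### Squared moduli and Lebesgue measure -/

theorem lintegral_Ioi_add_sq (c : ℝ) (g : ℝ → ENNReal) :
    ∫⁻ s in Set.Ioi c, g s = ∫⁻ x in Set.Ioi (0 : ℝ), ENNReal.ofReal (2 * x) * g (c + x ^ 2) := by
  have himg : (fun x : ℝ => c + x ^ 2) '' Set.Ioi 0 = Set.Ioi c := by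
    ext s
    simp only [Set.mem_image, Set.mem_Ioi]
    constructor
    · rintro ⟨x, hx, rfl⟩
      have := pow_pos hx 2
      linarith
    · intro hs
      refine ⟨Real.sqrt (s - c), Real.sqrt_pos.2 (by linarith), ?_⟩
      rw [Real.sq_sqrt (by linarith)]
      ring
  rw [← himg, lintegral_image_eq_lintegral_abs_deriv_mul (f' := fun x => 2 * x) measurableSet_Ioi]
  · refine setLIntegral_congr_fun measurableSet_Ioi fun x hx => ?_
    have hx' : (0 : ℝ) < x := hx
    rw [abs_of_pos (by linarith)]
  · intro x _
    have := ((hasDerivAt_pow 2 x).const_add c).hasDerivWithinAt (s := Set.Ioi 0)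
    simpa using this
  · intro x hx y hy h
    have hx' : (0 : ℝ) < x := hx
    have hy' : (0 : ℝ) < y := hy
    have : x ^ 2 = y ^ 2 := by simpa using h
    exact (pow_left_inj₀ hx'.le hy'.le two_ne_zero).1 this

theorem lintegral_Ioi_zero_const_mul {c : ℝ} (hc : 0 < c) (g : ℝ → ENNReal) :
    ∫⁻ x in Set.Ioi (0 : ℝ), ENNReal.ofReal c * g (c * x) = ∫⁻ s in Set.Ioi (0 : ℝ), g s := by
  have himg : (fun x : ℝ => c * x) '' Set.Ioi 0 = Set.Ioi 0 := by
    simpa using Set.image_mul_left_Ioi hc 0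
  conv_rhs => rw [← himg]
  rw [lintegral_image_eq_lintegral_abs_deriv_mul (f' := fun _ => c) measurableSet_Ioi]
  · simp only [abs_of_pos hc]
  · intro x _
    simpa using ((hasDerivAt_id x).const_mul c).hasDerivWithinAt (s := Set.Ioi 0)
  · intro x _ y _ h
    exact mul_left_cancel₀ hc.ne' h

/-- In polar coordinates the angle integrates to `2π`, and `2πr dr = d(πr²)`. -/
theorem map_pi_mul_norm_sq_volume :
    (volume : Measure ℂ).map (fun z => Real.pi * ‖z‖ ^ 2) = volume.restrict (Set.Ici 0) := by
  rw [← Measure.restrict_congr_set Ioi_ae_eq_Ici]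
  have hm : Measurable fun z : ℂ => Real.pi * ‖z‖ ^ 2 := by fun_prop
  refine Measure.ext_of_lintegral _ fun g hg => ?_
  rw [lintegral_map hg hm, ← Complex.lintegral_comp_polarCoord_symm]
  have h1 : ∀ p ∈ polarCoord.target,
      ENNReal.ofReal p.1 • g (Real.pi * ‖Complex.polarCoord.symm p‖ ^ 2)
        = ENNReal.ofReal p.1 * g (Real.pi * p.1 ^ 2) := by
    intro p _
    rw [Complex.norm_polarCoord_symm, sq_abs, smul_eq_mul]
  rw [setLIntegral_congr_fun polarCoord.open_target.measurableSet h1, polarCoord_target,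
    Measure.volume_eq_prod, ← Measure.prod_restrict, lintegral_prod _ (by fun_prop)]
  simp only [lintegral_const, Measure.restrict_apply_univ, Real.volume_Ioo]
  have h2 := lintegral_Ioi_add_sq 0 fun s => ENNReal.ofReal Real.pi * g (Real.pi * s)
  rw [lintegral_Ioi_zero_const_mul Real.pi_pos g] at h2
  rw [h2]
  refine setLIntegral_congr_fun measurableSet_Ioi fun x hx => ?_
  have hx' : (0 : ℝ) < x := hx
  simp only [zero_add]
  rw [mul_right_comm, ← ENNReal.ofReal_mul hx'.le, ← mul_assoc, ← ENNReal.ofReal_mul (by linarith)]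
  ring_nf

theorem map_pi_mul_norm_sq_volume_pi (ι : Type*) [Fintype ι] :
    (volume : Measure (ι → ℂ)).map (fun x i => Real.pi * ‖x i‖ ^ 2)
      = volume.restrict (Set.univ.pi fun _ => Set.Ici 0) := by
  have : SigmaFinite ((volume : Measure ℂ).map fun z => Real.pi * ‖z‖ ^ 2) := by
    rw [map_pi_mul_norm_sq_volume]
    infer_instance
  rw [volume_pi, volume_pi, Measure.restrict_pi_pi, ← map_pi_mul_norm_sq_volume]
  exact Measure.pi_map_pi (f := fun _ (z : ℂ) => Real.pi * ‖z‖ ^ 2)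
    fun _ => Measurable.aemeasurable (by fun_prop)

/-! ### Unit ball and orthonormal coordinates -/

theorem Gamma_four : Real.Gamma 4 = 6 := by
  simp [Nat.factorial]

theorem volume_ball_quditSpace_three :
    volume (Metric.ball (0 : QuditSpace 3) 1) = ENNReal.ofReal (Real.pi ^ 3 / 6) := by
  have hdim : Module.finrank ℝ (QuditSpace 3) = 6 := by
    rw [← Module.finrank_mul_finrank ℝ ℂ]
    simp
  have hpi : Real.sqrt Real.pi ^ 6 = Real.pi ^ 3 := by
    rw [show 6 = 2 * 3 by norm_num, pow_mul, Real.sq_sqrt Real.pi_pos.le]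
  rw [InnerProductSpace.volume_ball, hdim, hpi]
  norm_num [Gamma_four]

/-- The image of volume is a Haar measure, so it is a multiple of Lebesgue measure. The factor is 1
because the unit balls on both sides have volume `π³/6`. -/
theorem measurePreserving_inner_orthonormalBasis
    (b : OrthonormalBasis (Fin 3) ℂ (QuditSpace 3)) :
    MeasurePreserving (fun (x : QuditSpace 3) i => inner ℂ (b i) x) volume volume := by
  let e : QuditSpace 3 ≃L[ℝ] (Fin 3 → ℂ) :=
    (LinearEquiv.toContinuousLinearEquiv
      ((b.repr.toLinearEquiv.trans (WithLp.linearEquiv 2 ℂ (Fin 3 → ℂ))).restrictScalars ℝ))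
  have he : ∀ x i, e x i = inner ℂ (b i) x := fun x i => b.repr_apply_apply x i
  have hfun : (fun (x : QuditSpace 3) i => inner ℂ (b i) x) = e := by
    ext x i
    exact (he x i).symm
  have hem : Measurable e := e.continuous.measurable
  rw [hfun]
  refine ⟨hem, ?_⟩
  have := e.isAddHaarMeasure_map (volume : Measure (QuditSpace 3))
  have hc := Measure.isAddLeftInvariant_eq_smul ((volume : Measure (QuditSpace 3)).map e) volume
  set c := Measure.addHaarScalarFactor ((volume : Measure (QuditSpace 3)).map e) volume
  have hball : e ⁻¹' {x | ∑ i, ‖x i‖ ^ (2 : ℝ) < 1} = Metric.ball 0 1 := by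
    ext x
    have hs : ∑ i, ‖e x i‖ ^ (2 : ℝ) = ‖x‖ ^ 2 := by
      simp only [he, Real.rpow_two]
      exact b.sum_sq_norm_inner_right x
    rw [Set.mem_preimage, Set.mem_ofPred_eq, hs, mem_ball_zero_iff, sq_lt_one_iff₀ (norm_nonneg _)]
  have hmeas : MeasurableSet {x : Fin 3 → ℂ | ∑ i, ‖x i‖ ^ (2 : ℝ) < 1} :=
    measurableSet_lt (by fun_prop) measurable_const
  have hv := Complex.volume_sum_rpow_lt_one (Fin 3) (p := 2) (by norm_num)
  have hG2 : Real.Gamma 2 = 1 := by simp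
  have hv' : volume {x : Fin 3 → ℂ | ∑ i, ‖x i‖ ^ (2 : ℝ) < 1}
      = ENNReal.ofReal (Real.pi ^ 3 / 6) := by
    rw [hv]
    norm_num [Gamma_four, hG2]
  have h1 := Measure.map_apply (μ := volume) hem hmeas
  rw [hball, volume_ball_quditSpace_three, hc, Measure.smul_apply, hv'] at h1
  have hpos : ENNReal.ofReal (Real.pi ^ 3 / 6) ≠ 0 := by
    have := Real.pi_pos
    exact (ENNReal.ofReal_pos.2 (by positivity)).ne'
  have hc1 : (c : ENNReal) = 1 :=
    (ENNReal.mul_left_inj hpos ENNReal.ofReal_ne_top).1 (by rw [one_mul]; exact h1)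
  rw [hc, ENNReal.coe_eq_one.1 hc1, one_smul]

/-! ### The moment triangle and volumes of cones -/

/-- The triangle with vertices `(aᵢ, aᵢ²)`, for `a₁ < a₂ < a₃`. -/
def momentTriangle (a₁ a₂ a₃ : ℝ) : Set (ℝ × ℝ) :=
  {p | (a₁ + a₂) * p.1 - a₁ * a₂ ≤ p.2 ∧ (a₂ + a₃) * p.1 - a₂ * a₃ ≤ p.2 ∧
    p.2 ≤ (a₁ + a₃) * p.1 - a₁ * a₃}

theorem V3_pos {a₁ a₂ a₃ : ℝ} (h₁₂ : a₁ < a₂) (h₂₃ : a₂ < a₃) : 0 < V3 a₁ a₂ a₃ :=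
  mul_pos (mul_pos (by linarith) (by linarith)) (by linarith)

/-- The two lower chords differ by `(a₃ - a₁)(a₂ - r)`, so the binding one changes at `r = a₂`. The
bounds on `r` hold because the upper chord exceeds the lower ones by `(a₃ - a₂)(r - a₁)` and `(a₂ -
a₁)(a₃ - r)`. -/
theorem regionD₁_union_regionD₂ {a₁ a₂ a₃ : ℝ} (h₁₂ : a₁ < a₂) (h₂₃ : a₂ < a₃) :
    regionD₁ a₁ a₂ a₃ ∪ regionD₂ a₁ a₂ a₃ = momentTriangle a₁ a₂ a₃ := by
  ext ⟨r, s⟩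
  simp only [regionD₁, regionD₂, momentTriangle, Set.mem_union, Set.mem_ofPred_eq]
  constructor
  · rintro (⟨h1, h2, h3, h4⟩ | ⟨h1, h2, h3, h4⟩)
    · exact ⟨h3, by nlinarith, h4⟩
    · exact ⟨by nlinarith, h3, h4⟩
  · rintro ⟨h1, h2, h3⟩
    have hr1 : a₁ ≤ r := by
      by_contra! h
      nlinarith [mul_pos (sub_pos.2 h₂₃) (sub_pos.2 h)]
    have hr3 : r ≤ a₃ := by
      by_contra! h
      nlinarith [mul_pos (sub_pos.2 h₁₂) (sub_pos.2 h)]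
    rcases le_total r a₂ with h | h
    · exact Or.inl ⟨hr1, h, h1, h3⟩
    · exact Or.inr ⟨h, hr3, h2, h3⟩

theorem measurableSet_momentTriangle (a₁ a₂ a₃ : ℝ) :
    MeasurableSet (momentTriangle a₁ a₂ a₃) := by
  have h : momentTriangle a₁ a₂ a₃ = {p | (a₁ + a₂) * p.1 - a₁ * a₂ ≤ p.2} ∩
      ({p | (a₂ + a₃) * p.1 - a₂ * a₃ ≤ p.2} ∩ {p | p.2 ≤ (a₁ + a₃) * p.1 - a₁ * a₃}) := rfl
  rw [h]
  refine (measurableSet_le ?_ ?_).inter ((measurableSet_le ?_ ?_).inter (measurableSet_le ?_ ?_)) <;>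
    fun_prop

/-- The slice at height `t` is `t • S`, of area `t²|S|`. -/
theorem volume_cone {S : Set (ℝ × ℝ)} (hS : MeasurableSet S) {c : ℝ} (hc : 0 ≤ c) :
    volume {u : Fin 3 → ℝ | u 0 ∈ Set.Ioo 0 c ∧ (u 1 / u 0, u 2 / u 0) ∈ S}
      = ENNReal.ofReal (c ^ 3 / 3) * volume S := by
  have e : MeasurePreserving
      (fun u : Fin 3 → ℝ => ((u 0, (u 1, u 2)) : ℝ × ℝ × ℝ)) volume volume :=
    ((MeasurePreserving.id volume).prod (volume_preserving_finTwoArrow ℝ)).comp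
      (volume_preserving_piFinSuccAbove (fun _ : Fin 3 => ℝ) 0)
  let C : Set (ℝ × ℝ × ℝ) := {q | q.1 ∈ Set.Ioo 0 c ∧ (q.2.1 / q.1, q.2.2 / q.1) ∈ S}
  have hC : MeasurableSet C := by
    refine (measurable_fst measurableSet_Ioo).inter
      ((by fun_prop : Measurable fun q : ℝ × ℝ × ℝ => (q.2.1 / q.1, q.2.2 / q.1)) hS)
  have hslice : ∀ t : ℝ, volume (Prod.mk t ⁻¹' C)
      = (Set.Ioo 0 c).indicator (fun t => ENNReal.ofReal (t ^ 2) * volume S) t := by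
    intro t
    by_cases ht : t ∈ Set.Ioo 0 c
    · have hset : Prod.mk t ⁻¹' C = (fun x : ℝ × ℝ => t⁻¹ • x) ⁻¹' S := by
        ext x
        simp [C, ht.1, ht.2, div_eq_inv_mul, Prod.smul_def]
      rw [Set.indicator_of_mem ht, hset, Measure.addHaar_preimage_smul _ (inv_ne_zero ht.1.ne')]
      simp [Module.finrank_prod]
    · have hset : Prod.mk t ⁻¹' C = ∅ := by
        ext x
        simp only [C, Set.mem_preimage, Set.mem_ofPred_eq, ht, false_and, Set.mem_empty_iff_false]
      rw [Set.indicator_of_notMem ht, hset, measure_empty]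
  have hint : ∫⁻ t in Set.Ioo 0 c, ENNReal.ofReal (t ^ 2) = ENNReal.ofReal (c ^ 3 / 3) := by
    rw [← ofReal_integral_eq_lintegral_ofReal, ← integral_Ioc_eq_integral_Ioo,
      ← intervalIntegral.integral_of_le hc, integral_pow]
    · norm_num
    · exact ((continuous_pow 2).integrableOn_Icc).mono_set Set.Ioo_subset_Icc_self
    · exact Filter.Eventually.of_forall fun t => sq_nonneg t
  calc volume {u : Fin 3 → ℝ | u 0 ∈ Set.Ioo 0 c ∧ (u 1 / u 0, u 2 / u 0) ∈ S}
      = volume C := e.measure_preimage hC.nullMeasurableSet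
    _ = ∫⁻ t, volume (Prod.mk t ⁻¹' C) := by
      rw [Measure.volume_eq_prod, Measure.prod_apply hC]
    _ = ENNReal.ofReal (c ^ 3 / 3) * volume S := by
      simp only [hslice]
      rw [lintegral_indicator measurableSet_Ioo, lintegral_mul_const _ (by fun_prop), hint]

theorem volume_simplexCone {a₁ a₂ a₃ : ℝ} (h₁₂ : a₁ < a₂) (h₂₃ : a₂ < a₃) {c : ℝ} (hc : 0 ≤ c)
    {S : Set (ℝ × ℝ)} (hS : MeasurableSet S) :
    volume {y : Fin 3 → ℝ | (∀ i, 0 ≤ y i) ∧ y 0 + y 1 + y 2 ∈ Set.Ioo 0 c ∧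
        ((a₁ * y 0 + a₂ * y 1 + a₃ * y 2) / (y 0 + y 1 + y 2),
          (a₁ ^ 2 * y 0 + a₂ ^ 2 * y 1 + a₃ ^ 2 * y 2) / (y 0 + y 1 + y 2)) ∈ S}
      = ENNReal.ofReal (c ^ 3 / (3 * V3 a₁ a₂ a₃)) * volume (S ∩ momentTriangle a₁ a₂ a₃) := by
  have hV := V3_pos h₁₂ h₂₃
  let M : Matrix (Fin 3) (Fin 3) ℝ := !![1, 1, 1; a₁, a₂, a₃; a₁ ^ 2, a₂ ^ 2, a₃ ^ 2]
  have hdet : LinearMap.det (Matrix.toLin' M) = V3 a₁ a₂ a₃ := by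
    rw [LinearMap.det_toLin', Matrix.det_fin_three, V3]
    simp [M]
    ring
  have hM0 : ∀ y, Matrix.toLin' M y 0 = y 0 + y 1 + y 2 := fun y => by
    simp [M, Matrix.mulVec, dotProduct, Fin.sum_univ_three]
  have hM1 : ∀ y, Matrix.toLin' M y 1 = a₁ * y 0 + a₂ * y 1 + a₃ * y 2 := fun y => by
    simp [M, Matrix.mulVec, dotProduct, Fin.sum_univ_three]
  have hM2 : ∀ y, Matrix.toLin' M y 2 = a₁ ^ 2 * y 0 + a₂ ^ 2 * y 1 + a₃ ^ 2 * y 2 := fun y => by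
    simp [M, Matrix.mulVec, dotProduct, Fin.sum_univ_three]
  have hset : {y : Fin 3 → ℝ | (∀ i, 0 ≤ y i) ∧ y 0 + y 1 + y 2 ∈ Set.Ioo 0 c ∧
        ((a₁ * y 0 + a₂ * y 1 + a₃ * y 2) / (y 0 + y 1 + y 2),
          (a₁ ^ 2 * y 0 + a₂ ^ 2 * y 1 + a₃ ^ 2 * y 2) / (y 0 + y 1 + y 2)) ∈ S}
      = Matrix.toLin' M ⁻¹' {u | u 0 ∈ Set.Ioo 0 c ∧
          (u 1 / u 0, u 2 / u 0) ∈ S ∩ momentTriangle a₁ a₂ a₃} := by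
    ext y
    rw [Set.mem_preimage, Set.mem_ofPred_eq, Set.mem_ofPred_eq, Set.mem_inter_iff, hM0, hM1, hM2,
      and_comm (b := _ ∈ momentTriangle _ _ _), ← and_assoc, ← and_assoc,
      and_comm (a := ∀ i, 0 ≤ y i)]
    refine and_congr_left fun _ => and_congr_right fun ht => ?_
    have ht0 : y 0 + y 1 + y 2 ≠ 0 := ht.1.ne'
    -- Applied to a chord through the nodes `aᵢ`, `aⱼ`: the left side is `∑ (a - aᵢ)(a - aⱼ) y` over
    -- the three nodes, and only the third node survives. Each edge of the triangle thus encodes the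
    -- sign of one `y k`; for the middle node the coefficient is negative, which gives the upper
    -- edge.
    have key : ∀ (p q d z : ℝ), 0 < d →
        (a₁ ^ 2 * y 0 + a₂ ^ 2 * y 1 + a₃ ^ 2 * y 2
          - (p * (a₁ * y 0 + a₂ * y 1 + a₃ * y 2) - q * (y 0 + y 1 + y 2)) = d * z) →
        (p * ((a₁ * y 0 + a₂ * y 1 + a₃ * y 2) / (y 0 + y 1 + y 2)) - q
          ≤ (a₁ ^ 2 * y 0 + a₂ ^ 2 * y 1 + a₃ ^ 2 * y 2) / (y 0 + y 1 + y 2) ↔ 0 ≤ z) := by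
      intro p q d z hd h
      rw [le_div_iff₀ ht.1, ← sub_nonneg, ← mul_nonneg_iff_of_pos_left (b := z) hd, ← h]
      field_simp
    have key' : (a₁ ^ 2 * y 0 + a₂ ^ 2 * y 1 + a₃ ^ 2 * y 2) / (y 0 + y 1 + y 2)
          ≤ (a₁ + a₃) * ((a₁ * y 0 + a₂ * y 1 + a₃ * y 2) / (y 0 + y 1 + y 2)) - a₁ * a₃
        ↔ 0 ≤ y 1 := by
      have hd : 0 < (a₂ - a₁) * (a₃ - a₂) := mul_pos (by linarith) (by linarith)
      have h : ((a₁ + a₃) * (a₁ * y 0 + a₂ * y 1 + a₃ * y 2) - a₁ * a₃ * (y 0 + y 1 + y 2))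
          - (a₁ ^ 2 * y 0 + a₂ ^ 2 * y 1 + a₃ ^ 2 * y 2)
          = (a₂ - a₁) * (a₃ - a₂) * y 1 := by ring
      rw [div_le_iff₀ ht.1, ← sub_nonneg, ← mul_nonneg_iff_of_pos_left (b := y 1) hd, ← h]
      field_simp
    simp only [momentTriangle, Set.mem_ofPred_eq]
    rw [key (a₁ + a₂) (a₁ * a₂) ((a₃ - a₁) * (a₃ - a₂)) (y 2)
        (mul_pos (by linarith) (by linarith)) (by ring),
      key (a₂ + a₃) (a₂ * a₃) ((a₂ - a₁) * (a₃ - a₁)) (y 0)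
        (mul_pos (by linarith) (by linarith)) (by ring), key']
    simp only [Fin.forall_fin_succ, Fin.isValue]
    simp
    tauto
  rw [hset, Measure.addHaar_preimage_linearMap _ (by rw [hdet]; exact hV.ne'), hdet,
    volume_cone (hS.inter (measurableSet_momentTriangle _ _ _)) hc, ← mul_assoc,
    ← ENNReal.ofReal_mul (abs_nonneg _), abs_of_pos (inv_pos.2 hV)]
  congr 2
  field_simp

/-! ### Eigenbasis and the law of the two moments -/

theorem exists_orthonormalBasis_of_hasEigenvalue {A : QuditSpace 3 →ₗ[ℂ] QuditSpace 3}
    (hA : A.IsSymmetric) {a : Fin 3 → ℝ} (ha : Function.Injective a)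
    (h : ∀ i, Module.End.HasEigenvalue A (a i : ℂ)) :
    ∃ b : OrthonormalBasis (Fin 3) ℂ (QuditSpace 3), ∀ i, A (b i) = (a i : ℂ) • b i := by
  choose v hv using fun i => (h i).exists_hasEigenvector
  have hn : ∀ i, (‖v i‖ : ℂ) ≠ 0 := fun i => by
    simpa using (hv i).2
  have hA' : ∀ i, A (v i) = (a i : ℂ) • v i := fun i => (hv i).apply_eq_smul
  have horth : ∀ i j, i ≠ j → inner ℂ (v i) (v j) = 0 := fun i j hij =>
    hA.orthogonalFamily_eigenspaces (i := (a i : ℂ)) (j := (a j : ℂ))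
      (fun e => hij (ha (Complex.ofReal_injective e))) ⟨v i, (hv i).1⟩ ⟨v j, (hv j).1⟩
  have hon : Orthonormal ℂ fun i => (‖v i‖ : ℂ)⁻¹ • v i := by
    refine ⟨fun i => ?_, fun i j hij => ?_⟩
    · have := hn i
      rw [norm_smul, norm_inv, Complex.norm_real, norm_norm]
      exact inv_mul_cancel₀ (by exact_mod_cast this)
    · simp only [inner_smul_left, inner_smul_right, horth i j hij, mul_zero]
  let B := basisOfOrthonormalOfCardEqFinrank hon (by simp)
  have hB : ⇑B = fun i => (‖v i‖ : ℂ)⁻¹ • v i := coe_basisOfOrthonormalOfCardEqFinrank _ _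
  refine ⟨B.toOrthonormalBasis (by rw [hB]; exact hon), fun i => ?_⟩
  rw [Module.Basis.coe_toOrthonormalBasis, hB]
  simp only [map_smul, hA' i]
  rw [smul_comm]

theorem re_inner_apply_eq_sum {A : QuditSpace 3 →ₗ[ℂ] QuditSpace 3} (hA : A.IsSymmetric)
    (b : OrthonormalBasis (Fin 3) ℂ (QuditSpace 3)) {a : Fin 3 → ℝ}
    (hb : ∀ i, A (b i) = (a i : ℂ) • b i) (x : QuditSpace 3) :
    (inner ℂ x (A x)).re = ∑ i, a i * ‖inner ℂ (b i) x‖ ^ 2 := by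
  rw [← b.sum_inner_mul_inner x (A x), Complex.re_sum]
  refine Finset.sum_congr rfl fun i _ => ?_
  rw [← hA (b i) x, hb i, inner_smul_left, Complex.conj_ofReal, mul_left_comm,
    ← inner_conj_symm x (b i), ← Complex.normSq_eq_conj_mul_self, Complex.re_ofReal_mul,
    Complex.ofReal_re, Complex.normSq_eq_norm_sq]

theorem continuous_expectation {d : ℕ} (A : QuditSpace d →ₗ[ℂ] QuditSpace d) :
    Continuous (expectation A) := by
  have hA : Continuous A := A.continuous_of_finiteDimensional
  unfold expectation
  fun_prop

open scoped Pointwise in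
-- The surface measure of a set is 6 times the volume of its cone, and the factor 6 cancels on
-- normalizing. What remains is `(π³ / (3 V3)) / (π³ / 6) = 2 / V3`.
theorem haarState_three_preimage {b : OrthonormalBasis (Fin 3) ℂ (QuditSpace 3)}
    {a₁ a₂ a₃ : ℝ} (h₁₂ : a₁ < a₂) (h₂₃ : a₂ < a₃) {F : PureState 3 → ℝ × ℝ} (hF : Measurable F)
    (hFb : ∀ ψ, F ψ =
      (a₁ * ‖inner ℂ (b 0) ψ.1‖ ^ 2 + a₂ * ‖inner ℂ (b 1) ψ.1‖ ^ 2 + a₃ * ‖inner ℂ (b 2) ψ.1‖ ^ 2,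
        a₁ ^ 2 * ‖inner ℂ (b 0) ψ.1‖ ^ 2 + a₂ ^ 2 * ‖inner ℂ (b 1) ψ.1‖ ^ 2
          + a₃ ^ 2 * ‖inner ℂ (b 2) ψ.1‖ ^ 2))
    {S : Set (ℝ × ℝ)} (hS : MeasurableSet S) :
    haarState 3 (F ⁻¹' S)
      = ENNReal.ofReal (2 / V3 a₁ a₂ a₃) * volume (S ∩ momentTriangle a₁ a₂ a₃) := by
  have hV := V3_pos h₁₂ h₂₃
  have hpi := Real.pi_pos
  let Q : Set (Fin 3 → ℝ) := {y | y 0 + y 1 + y 2 ∈ Set.Ioo 0 Real.pi ∧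
        ((a₁ * y 0 + a₂ * y 1 + a₃ * y 2) / (y 0 + y 1 + y 2),
          (a₁ ^ 2 * y 0 + a₂ ^ 2 * y 1 + a₃ ^ 2 * y 2) / (y 0 + y 1 + y 2)) ∈ S}
  have hQ : MeasurableSet Q := by
    refine MeasurableSet.inter ?_ ?_
    · exact (by fun_prop : Measurable fun y : Fin 3 → ℝ => y 0 + y 1 + y 2) measurableSet_Ioo
    · exact (by fun_prop : Measurable fun y : Fin 3 → ℝ =>
        ((a₁ * y 0 + a₂ * y 1 + a₃ * y 2) / (y 0 + y 1 + y 2),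
          (a₁ ^ 2 * y 0 + a₂ ^ 2 * y 1 + a₃ ^ 2 * y 2) / (y 0 + y 1 + y 2))) hS
  let G : (Fin 3 → ℂ) → Fin 3 → ℝ := fun x i => Real.pi * ‖x i‖ ^ 2
  have hG : Measurable G := by fun_prop
  have hcone : Set.Ioo (0 : ℝ) 1 • (Subtype.val '' (F ⁻¹' S))
      = (fun (x : QuditSpace 3) i => inner ℂ (b i) x) ⁻¹' (G ⁻¹' Q) := by
    have hsum : ∀ x : QuditSpace 3, Real.pi * ‖inner ℂ (b 0) x‖ ^ 2
        + Real.pi * ‖inner ℂ (b 1) x‖ ^ 2 + Real.pi * ‖inner ℂ (b 2) x‖ ^ 2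
        = Real.pi * ‖x‖ ^ 2 := fun x => by
      rw [← b.sum_sq_norm_inner_right x, Fin.sum_univ_three]
      ring
    -- The quotients in `Q` are invariant under scaling, while the coordinate sum is `π‖x‖²`; hence
    -- the range `(0, π)` for the open unit ball without its centre.
    have hhom : ∀ (t : ℝ) (ψ : PureState 3), 0 < t →
        ((fun (x : QuditSpace 3) i => inner ℂ (b i) x) (t • ψ.1) ∈ G ⁻¹' Q ↔
          t < 1 ∧ ψ ∈ F ⁻¹' S) := by
      intro t ψ ht
      have hψ : ‖ψ.1‖ = 1 := by simp
      have hin : ∀ i, ‖inner ℂ (b i) (t • ψ.1)‖ ^ 2 = t ^ 2 * ‖inner ℂ (b i) ψ.1‖ ^ 2 := by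
        intro i
        rw [inner_smul_right_eq_smul, norm_smul, mul_pow, Real.norm_eq_abs, sq_abs]
      simp only [Set.mem_preimage, Q, G, Set.mem_ofPred_eq, hsum]
      simp only [hin]
      rw [hFb, norm_smul, hψ, mul_one, Real.norm_eq_abs, sq_abs]
      refine and_congr ?_ ?_
      · rw [Set.mem_Ioo, mul_lt_iff_lt_one_right hpi, sq_lt_one_iff₀ ht.le]
        exact and_iff_right (by positivity)
      · have h : ∀ u v w : ℝ, (u * (Real.pi * (t ^ 2 * ‖inner ℂ (b 0) ψ.1‖ ^ 2))
            + v * (Real.pi * (t ^ 2 * ‖inner ℂ (b 1) ψ.1‖ ^ 2))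
            + w * (Real.pi * (t ^ 2 * ‖inner ℂ (b 2) ψ.1‖ ^ 2))) / (Real.pi * t ^ 2)
            = u * ‖inner ℂ (b 0) ψ.1‖ ^ 2 + v * ‖inner ℂ (b 1) ψ.1‖ ^ 2
              + w * ‖inner ℂ (b 2) ψ.1‖ ^ 2 := by
          intro u v w
          field_simp
        rw [h, h]
    ext x
    rw [Set.mem_smul]
    constructor
    · rintro ⟨t, ht, _, ⟨ψ, hψ, rfl⟩, rfl⟩
      exact (hhom t ψ ht.1).2 ⟨ht.2, hψ⟩
    · intro hx
      have hx0 : 0 < ‖x‖ := by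
        have h0 := hx.1.1
        simp only [G, hsum] at h0
        rcases (norm_nonneg x).eq_or_lt with h | h
        · simp [← h] at h0
        · exact h
      let ψ : PureState 3 := ⟨‖x‖⁻¹ • x, by simp [norm_smul, hx0.ne']⟩
      have hxψ : ‖x‖ • ψ.1 = x := smul_inv_smul₀ hx0.ne' x
      have h := (hhom ‖x‖ ψ hx0).1 (by rw [hxψ]; exact hx)
      exact ⟨‖x‖, ⟨hx0, h.1⟩, ψ.1, ⟨ψ, h.2, rfl⟩, hxψ⟩
  have hvol : volume (Set.Ioo (0 : ℝ) 1 • (Subtype.val '' (F ⁻¹' S)) : Set (QuditSpace 3))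
      = ENNReal.ofReal (Real.pi ^ 3 / (3 * V3 a₁ a₂ a₃))
        * volume (S ∩ momentTriangle a₁ a₂ a₃) := by
    rw [hcone, (measurePreserving_inner_orthonormalBasis b).measure_preimage
      (hG hQ).nullMeasurableSet, ← Measure.map_apply hG hQ, map_pi_mul_norm_sq_volume_pi,
      Measure.restrict_apply hQ, ← volume_simplexCone h₁₂ h₂₃ hpi.le hS, Set.inter_comm]
    congr 1
    ext y
    simp [Q, Pi.le_def]
  have hdim : Module.finrank ℝ (QuditSpace 3) = 6 := by
    rw [← Module.finrank_mul_finrank ℝ ℂ]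
    simp
  rw [haarState, Measure.smul_apply, Measure.toSphere_apply_univ, Measure.toSphere_apply' _ (hF hS),
    hvol, hdim, volume_ball_quditSpace_three, smul_eq_mul, ← mul_assoc, ← mul_assoc,
    show ((6 : ℕ) : ENNReal) = ENNReal.ofReal 6 by norm_num, ← ENNReal.ofReal_mul (by norm_num),
    ← ENNReal.ofReal_inv_of_pos (by positivity), ← ENNReal.ofReal_mul (by positivity),
    ← ENNReal.ofReal_mul (by positivity)]
  congr 2
  field_simp
  norm_num

theorem hasDensity_expectation_expectation_sq {A : QuditSpace 3 →ₗ[ℂ] QuditSpace 3}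
    (hA : A.IsSymmetric) {a₁ a₂ a₃ : ℝ} (h₁₂ : a₁ < a₂) (h₂₃ : a₂ < a₃)
    (h₁ : Module.End.HasEigenvalue A (a₁ : ℂ)) (h₂ : Module.End.HasEigenvalue A (a₂ : ℂ))
    (h₃ : Module.End.HasEigenvalue A (a₃ : ℂ)) :
    HasDensity (fun ψ => (expectation A ψ, expectation (A ^ 2) ψ)) (haarState 3)
      ((momentTriangle a₁ a₂ a₃).indicator fun _ => 2 / V3 a₁ a₂ a₃) := by
  have hV := V3_pos h₁₂ h₂₃
  have hT := measurableSet_momentTriangle a₁ a₂ a₃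
  have hinj : Function.Injective ![a₁, a₂, a₃] := by
    intro i j
    fin_cases i <;> fin_cases j <;> simp <;> linarith
  obtain ⟨b, hb⟩ := exists_orthonormalBasis_of_hasEigenvalue hA hinj (by
    intro i
    fin_cases i
    exacts [h₁, h₂, h₃])
  have hb2 : ∀ i, (A ^ 2) (b i) = ((![a₁, a₂, a₃] i ^ 2 : ℝ) : ℂ) • b i := fun i => by
    rw [pow_two, Module.End.mul_apply, hb, map_smul, hb, smul_smul]
    push_cast
    ring_nf
  have hF : Measurable fun ψ => (expectation A ψ, expectation (A ^ 2) ψ) :=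
    ((continuous_expectation A).prodMk (continuous_expectation (A ^ 2))).measurable
  refine ⟨hF.aemeasurable, measurable_const.indicator hT,
    Set.indicator_nonneg fun _ _ => by positivity, Measure.ext fun S hS => ?_⟩
  rw [Measure.map_apply hF hS, haarState_three_preimage (b := b) h₁₂ h₂₃ hF _ hS,
    withDensity_apply _ hS]
  · have h : ∀ x, ENNReal.ofReal ((momentTriangle a₁ a₂ a₃).indicator
        (fun _ => 2 / V3 a₁ a₂ a₃) x) = (momentTriangle a₁ a₂ a₃).indicator
        (fun _ => ENNReal.ofReal (2 / V3 a₁ a₂ a₃)) x := fun x => by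
      by_cases hx : x ∈ momentTriangle a₁ a₂ a₃ <;> simp [hx]
    simp only [h]
    rw [lintegral_indicator hT, setLIntegral_const, Measure.restrict_apply hT, Set.inter_comm]
  · intro ψ
    have e1 := re_inner_apply_eq_sum hA b hb ψ.1
    have e2 := re_inner_apply_eq_sum (hA.pow 2) b hb2 ψ.1
    rw [Fin.sum_univ_three] at e1 e2
    exact Prod.ext e1 e2

/-! ### From second moment to uncertainty -/

/-- With `s = r² + x²`, the height of `s` above the chord through `a`, `b` is `x² - (a - r)(r - b)`.
-/
theorem regionR₁_union_regionR₂ {a₁ a₂ a₃ : ℝ} (h₁₂ : a₁ < a₂) (h₂₃ : a₂ < a₃) :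
    regionR₁ a₁ a₂ a₃ ∪ regionR₂ a₁ a₂ a₃
      = {p | 0 ≤ p.2 ∧ (p.1, p.1 ^ 2 + p.2 ^ 2) ∈ momentTriangle a₁ a₂ a₃} := by
  ext ⟨r, x⟩
  rw [← regionD₁_union_regionD₂ h₁₂ h₂₃]
  simp only [regionR₁, regionR₂, regionD₁, regionD₂, Set.mem_union, Set.mem_ofPred_eq,
    Real.sqrt_le_iff]
  have hup : 0 ≤ x → a₁ ≤ r → r ≤ a₃ → (x ≤ Real.sqrt ((a₃ - r) * (r - a₁)) ↔
      r ^ 2 + x ^ 2 ≤ (a₁ + a₃) * r - a₁ * a₃) := by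
    intro hx h1 h3
    constructor
    · intro h
      have := (Real.le_sqrt hx (mul_nonneg (by linarith) (by linarith))).1 h
      linarith
    · intro h
      exact Real.le_sqrt_of_sq_le (by linarith)
  constructor
  · rintro (⟨h1, h2, ⟨h3, h4⟩, h5⟩ | ⟨h1, h2, ⟨h3, h4⟩, h5⟩)
    · exact ⟨h3, Or.inl ⟨h1, h2, by linarith, (hup h3 h1 (by linarith)).1 h5⟩⟩
    · exact ⟨h3, Or.inr ⟨h1, h2, by linarith, (hup h3 (by linarith) h2).1 h5⟩⟩
  · rintro ⟨h3, ⟨h1, h2, h4, h5⟩ | ⟨h1, h2, h4, h5⟩⟩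
    · exact Or.inl ⟨h1, h2, ⟨h3, by linarith⟩, (hup h3 h1 (by linarith)).2 h5⟩
    · exact Or.inr ⟨h1, h2, ⟨h3, by linarith⟩, (hup h3 (by linarith) h2).2 h5⟩

theorem measurableSet_regionR {a₁ a₂ a₃ : ℝ} (h₁₂ : a₁ < a₂) (h₂₃ : a₂ < a₃) :
    MeasurableSet (regionR₁ a₁ a₂ a₃ ∪ regionR₂ a₁ a₂ a₃) := by
  rw [regionR₁_union_regionR₂ h₁₂ h₂₃]
  exact (measurableSet_le measurable_const measurable_snd).inter
    ((by fun_prop : Measurable fun p : ℝ × ℝ => (p.1, p.1 ^ 2 + p.2 ^ 2))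
      (measurableSet_momentTriangle a₁ a₂ a₃))

theorem sq_le_of_mem_momentTriangle {a₁ a₂ a₃ r s : ℝ} (h₁₂ : a₁ < a₂) (h₂₃ : a₂ < a₃)
    (h : (r, s) ∈ momentTriangle a₁ a₂ a₃) : r ^ 2 ≤ s := by
  rw [← regionD₁_union_regionD₂ h₁₂ h₂₃] at h
  rcases h with ⟨h1, h2, h3, -⟩ | ⟨h1, h2, h3, -⟩ <;>
    nlinarith [mul_nonneg (sub_nonneg.2 h1) (sub_nonneg.2 h2)]

/-- On each fibre of fixed `r`, substitute `s = r² + x²`. Hypothesis `h0` is essential: `Real.sqrt`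
sends all `s < r²` to 0, so mass there would collapse onto the line `x = 0`. -/
theorem map_sqrt_sub_sq_withDensity {f : ℝ × ℝ → ENNReal} (hf : Measurable f)
    (h0 : ∀ r s, s < r ^ 2 → f (r, s) = 0) :
    (volume.withDensity f).map (fun p => (p.1, Real.sqrt (p.2 - p.1 ^ 2)))
      = volume.withDensity ({p : ℝ × ℝ | 0 < p.2}.indicator fun p =>
          ENNReal.ofReal (2 * p.2) * f (p.1, p.1 ^ 2 + p.2 ^ 2)) := by
  have hh : Measurable fun p : ℝ × ℝ => (p.1, Real.sqrt (p.2 - p.1 ^ 2)) := by fun_prop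
  have hpos : MeasurableSet {p : ℝ × ℝ | 0 < p.2} := measurableSet_lt measurable_const measurable_snd
  have hd : Measurable fun p : ℝ × ℝ =>
      ENNReal.ofReal (2 * p.2) * f (p.1, p.1 ^ 2 + p.2 ^ 2) := by fun_prop
  refine Measure.ext_of_lintegral _ fun g hg => ?_
  rw [lintegral_map hg hh]
  have hcomp := lintegral_withDensity_eq_lintegral_mul volume hf (hg.comp hh)
  simp only [Function.comp_apply] at hcomp
  rw [hcomp, lintegral_withDensity_eq_lintegral_mul _ (hd.indicator hpos) hg, Measure.volume_eq_prod,
    lintegral_prod _ (hf.mul (hg.comp hh)).aemeasurable,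
    lintegral_prod _ ((hd.indicator hpos).mul hg).aemeasurable]
  refine lintegral_congr fun r => ?_
  have hl : ∫⁻ s, (f * (g ∘ fun p : ℝ × ℝ => (p.1, Real.sqrt (p.2 - p.1 ^ 2)))) (r, s)
      = ∫⁻ s in Set.Ioi (r ^ 2), f (r, s) * g (r, Real.sqrt (s - r ^ 2)) := by
    rw [restrict_Ioi_eq_restrict_Ici, ← lintegral_indicator measurableSet_Ici]
    refine lintegral_congr fun s => ?_
    by_cases hs : r ^ 2 ≤ s
    · rw [Set.indicator_of_mem (Set.mem_Ici.2 hs)]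
      rfl
    · rw [Set.indicator_of_notMem (by simpa using hs)]
      simp [h0 r s (not_le.1 hs)]
  have hr : ∫⁻ x, (({p : ℝ × ℝ | 0 < p.2}.indicator fun p =>
      ENNReal.ofReal (2 * p.2) * f (p.1, p.1 ^ 2 + p.2 ^ 2)) * g) (r, x)
      = ∫⁻ x in Set.Ioi 0, ENNReal.ofReal (2 * x) * f (r, r ^ 2 + x ^ 2) * g (r, x) := by
    rw [← lintegral_indicator measurableSet_Ioi]
    refine lintegral_congr fun x => ?_
    by_cases hx : 0 < x <;> simp [hx]
  rw [hl, hr, lintegral_Ioi_add_sq]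
  refine setLIntegral_congr_fun measurableSet_Ioi fun x hx => ?_
  have hx' : (0 : ℝ) < x := hx
  simp only [add_sub_cancel_left, Real.sqrt_sq hx'.le, mul_assoc]

/-! ### Slices of constant uncertainty -/

theorem map_snd_withDensity {f : ℝ × ℝ → ENNReal} (hf : Measurable f) :
    (volume.withDensity f).map Prod.snd = volume.withDensity fun x => ∫⁻ r, f (r, x) := by
  refine Measure.ext_of_lintegral _ fun g hg => ?_
  rw [lintegral_map hg measurable_snd]
  have hcomp := lintegral_withDensity_eq_lintegral_mul volume hf (hg.comp measurable_snd)
  simp only [Function.comp_apply] at hcomp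
  rw [hcomp, lintegral_withDensity_eq_lintegral_mul _ hf.lintegral_prod_left' hg, Measure.volume_eq_prod,
    lintegral_prod_symm _ (hf.mul (hg.comp measurable_snd)).aemeasurable]
  refine lintegral_congr fun x => ?_
  simp only [Pi.mul_apply, Function.comp_apply]
  rw [lintegral_mul_const _ (by fun_prop)]

theorem chiEps_of_neg {a b x : ℝ} (hx : x < 0) : chiEps a b x = 0 :=
  Set.indicator_of_notMem (fun h => hx.not_ge h.1) _

theorem chiEps_of_nonneg {a b x : ℝ} (h : b ≤ a) (hx : 0 ≤ x) :
    chiEps a b x = Real.sqrt (((a - b) / 2) ^ 2 - x ^ 2) := by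
  rw [chiEps, Set.indicator_apply]
  split_ifs with hm
  · rfl
  · have hlt : (a - b) / 2 < x := by
      by_contra! hle
      exact hm ⟨hx, hle⟩
    rw [Real.sqrt_eq_zero_of_nonpos]
    nlinarith

theorem chiEps_nonneg (a b x : ℝ) : 0 ≤ chiEps a b x :=
  Set.indicator_nonneg (fun _ _ => Real.sqrt_nonneg _) x

theorem measurable_chiEps (a b : ℝ) : Measurable (chiEps a b) :=
  Measurable.indicator (by fun_prop) measurableSet_Icc

/-- Complete the square: `(a - r)(r - b) = ((a - b)/2)² - (r - (a + b)/2)²`. With strict inequality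
this also covers radius 0, where both sides are empty. -/
theorem setOf_sq_lt_eq_ball {a b x : ℝ} (h : b ≤ a) (hx : 0 ≤ x) :
    {r : ℝ | x ^ 2 < (a - r) * (r - b)} = Metric.ball ((a + b) / 2) (chiEps a b x) := by
  ext r
  rw [Metric.mem_ball, Real.dist_eq, chiEps_of_nonneg h hx, Real.lt_sqrt (abs_nonneg _), sq_abs,
    Set.mem_ofPred_eq]
  constructor <;> intro h <;> linarith

theorem volume_setOf_sq_lt {a b x : ℝ} (h : b ≤ a) (hx : 0 ≤ x) :
    volume {r : ℝ | x ^ 2 < (a - r) * (r - b)} = ENNReal.ofReal (2 * chiEps a b x) := by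
  rw [setOf_sq_lt_eq_ball h hx, Real.volume_ball]

theorem volume_setOf_sq_le {a b x : ℝ} (h : b ≤ a) (hx : 0 ≤ x) :
    volume {r : ℝ | x ^ 2 ≤ (a - r) * (r - b)} = ENNReal.ofReal (2 * chiEps a b x) := by
  refine le_antisymm ?_ ?_
  · rw [← Real.volume_closedBall ((a + b) / 2)]
    refine measure_mono fun r hr => ?_
    have hr' : x ^ 2 ≤ (a - r) * (r - b) := hr
    rw [Metric.mem_closedBall, Real.dist_eq, chiEps_of_nonneg h hx]
    refine Real.abs_le_sqrt ?_
    linarith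
  · rw [← volume_setOf_sq_lt h hx]
    refine measure_mono fun r hr => ?_
    exact le_of_lt (show x ^ 2 < (a - r) * (r - b) from hr)

/-- The two removed intervals lie on opposite sides of `a₂` and inside the large one. Monotonicity
of measure then yields the inequality, which is the nonnegativity of the density in (iii). -/
theorem chiEps_add_le_and_volume_slice {a₁ a₂ a₃ x : ℝ} (h₁₂ : a₁ < a₂) (h₂₃ : a₂ < a₃)
    (hx : 0 < x) :
    chiEps a₃ a₂ x + chiEps a₂ a₁ x ≤ chiEps a₃ a₁ x ∧
      volume {r | (r, x) ∈ regionR₁ a₁ a₂ a₃ ∪ regionR₂ a₁ a₂ a₃}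
        = ENNReal.ofReal (2 * (chiEps a₃ a₁ x - chiEps a₃ a₂ x - chiEps a₂ a₁ x)) := by
  set J : ℝ → ℝ → Set ℝ := fun a b => {r : ℝ | x ^ 2 < (a - r) * (r - b)}
  have hbd : ∀ {a b r : ℝ}, b < a → r ∈ J a b → b < r ∧ r < a := by
    intro a b r hab hr
    have hr' : 0 < (a - r) * (r - b) := (pow_pos hx 2).trans hr
    rcases pos_and_pos_or_neg_and_neg_of_mul_pos hr' with h | h
    · exact ⟨by linarith [h.2], by linarith [h.1]⟩
    · linarith [h.1, h.2]
  have hJm : ∀ {a b}, b ≤ a → MeasurableSet (J a b) := fun hab => by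
    simp only [J, setOf_sq_lt_eq_ball hab hx.le]
    exact measurableSet_ball
  have hdisj : Disjoint (J a₃ a₂) (J a₂ a₁) := by
    refine Set.disjoint_left.2 fun r h h' => ?_
    linarith [(hbd h₂₃ h).1, (hbd h₁₂ h').2]
  have hsub : J a₃ a₂ ∪ J a₂ a₁ ⊆ {r : ℝ | x ^ 2 ≤ (a₃ - r) * (r - a₁)} := by
    rintro r (h | h)
    · have h' : x ^ 2 < (a₃ - r) * (r - a₂) := h
      have := hbd h₂₃ h
      simp only [Set.mem_ofPred_eq]
      nlinarith
    · have h' : x ^ 2 < (a₂ - r) * (r - a₁) := h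
      have := hbd h₁₂ h
      simp only [Set.mem_ofPred_eq]
      nlinarith
  have hunion : volume (J a₃ a₂ ∪ J a₂ a₁)
      = ENNReal.ofReal (2 * (chiEps a₃ a₂ x + chiEps a₂ a₁ x)) := by
    rw [measure_union hdisj (hJm h₁₂.le), volume_setOf_sq_lt h₂₃.le hx.le,
      volume_setOf_sq_lt h₁₂.le hx.le, mul_add,
      ENNReal.ofReal_add (by linarith [chiEps_nonneg a₃ a₂ x]) (by linarith [chiEps_nonneg a₂ a₁ x])]
  have hI := volume_setOf_sq_le (h₁₂.trans h₂₃).le hx.le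
  have hslice : {r | (r, x) ∈ regionR₁ a₁ a₂ a₃ ∪ regionR₂ a₁ a₂ a₃}
      = {r : ℝ | x ^ 2 ≤ (a₃ - r) * (r - a₁)} \ (J a₃ a₂ ∪ J a₂ a₁) := by
    ext r
    rw [regionR₁_union_regionR₂ h₁₂ h₂₃]
    simp only [momentTriangle, Set.mem_ofPred_eq, Set.mem_sdiff, Set.mem_union, J, not_or, not_lt]
    constructor
    · rintro ⟨-, h1, h2, h3⟩
      exact ⟨by linarith, by linarith, by linarith⟩
    · rintro ⟨h1, h2, h3⟩
      exact ⟨hx.le, by linarith, by linarith, by linarith⟩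
  have hm := measure_mono (μ := volume) hsub
  rw [hunion, hI, ENNReal.ofReal_le_ofReal_iff (by linarith [chiEps_nonneg a₃ a₁ x])] at hm
  refine ⟨by linarith, ?_⟩
  rw [hslice, measure_sdiff hsub ((hJm h₂₃.le).union (hJm h₁₂.le)).nullMeasurableSet
    (by rw [hunion]; exact ENNReal.ofReal_ne_top), hI, hunion,
    ← ENNReal.ofReal_sub _ (by linarith [chiEps_nonneg a₃ a₂ x, chiEps_nonneg a₂ a₁ x])]
  ring_nf

theorem mainTheorem6 (A : QuditSpace 3 →ₗ[ℂ] QuditSpace 3) (hA : A.IsSymmetric)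
    (a₁ a₂ a₃ : ℝ) (h₁₂ : a₁ < a₂) (h₂₃ : a₂ < a₃)
    (h₁ : Module.End.HasEigenvalue A (a₁ : ℂ))
    (h₂ : Module.End.HasEigenvalue A (a₂ : ℂ))
    (h₃ : Module.End.HasEigenvalue A (a₃ : ℂ)) :
    HasDensity (fun ψ => (expectation A ψ, expectation (A ^ 2) ψ)) (haarState 3)
      (Set.indicator (regionD₁ a₁ a₂ a₃ ∪ regionD₂ a₁ a₂ a₃)
        (fun _ => 2 / V3 a₁ a₂ a₃)) ∧
    HasDensity (fun ψ => (expectation A ψ, uncertainty A ψ)) (haarState 3)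
      (Set.indicator (regionR₁ a₁ a₂ a₃ ∪ regionR₂ a₁ a₂ a₃)
        (fun p => 4 / V3 a₁ a₂ a₃ * p.2)) ∧
    HasDensity (fun ψ => uncertainty A ψ) (haarState 3)
      (fun x => 8 / V3 a₁ a₂ a₃ * x *
        (chiEps a₃ a₁ x - chiEps a₃ a₂ x - chiEps a₂ a₁ x)) := by
  have hV := V3_pos h₁₂ h₂₃
  have hR := measurableSet_regionR h₁₂ h₂₃
  have hRdef := regionR₁_union_regionR₂ h₁₂ h₂₃
  have hi := hasDensity_expectation_expectation_sq hA h₁₂ h₂₃ h₁ h₂ h₃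
  have hmE : Measurable (expectation A) := (continuous_expectation A).measurable
  have hmE2 : Measurable (expectation (A ^ 2)) := (continuous_expectation (A ^ 2)).measurable
  have hmU : Measurable (uncertainty A) := (hmE2.sub (hmE.pow_const 2)).sqrt
  have hii : HasDensity (fun ψ => (expectation A ψ, uncertainty A ψ)) (haarState 3)
      (Set.indicator (regionR₁ a₁ a₂ a₃ ∪ regionR₂ a₁ a₂ a₃)
        (fun p => 4 / V3 a₁ a₂ a₃ * p.2)) := by
    refine ⟨(hmE.prodMk hmU).aemeasurable, Measurable.indicator (by fun_prop) hR,
      fun p => Set.indicator_nonneg (fun p hp => ?_) p, ?_⟩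
    · rw [hRdef] at hp
      exact mul_nonneg (by positivity) hp.1
    · have hcomp : (haarState 3).map (fun ψ => (expectation A ψ, uncertainty A ψ))
          = ((haarState 3).map fun ψ => (expectation A ψ, expectation (A ^ 2) ψ)).map
            fun p => (p.1, Real.sqrt (p.2 - p.1 ^ 2)) := by
        rw [Measure.map_map (by fun_prop) (hmE.prodMk hmE2)]
        rfl
      rw [hcomp, hi.2.2.2, map_sqrt_sub_sq_withDensity hi.2.1.ennreal_ofReal]
      · congr 1
        ext ⟨r, x⟩ : 1
        by_cases hx : 0 < x
        · rw [Set.indicator_of_mem (show (r, x) ∈ {p : ℝ × ℝ | 0 < p.2} from hx), ← ENNReal.ofReal_mul (by positivity)]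
          by_cases hm : (r, r ^ 2 + x ^ 2) ∈ momentTriangle a₁ a₂ a₃
          · rw [Set.indicator_of_mem hm, Set.indicator_of_mem (by rw [hRdef]; exact ⟨hx.le, hm⟩)]
            ring_nf
          · rw [Set.indicator_of_notMem hm,
              Set.indicator_of_notMem (by rw [hRdef]; exact fun h => hm h.2), mul_zero]
        · rw [Set.indicator_of_notMem (show (r, x) ∉ {p : ℝ × ℝ | 0 < p.2} from hx)]
          by_cases hm : (r, x) ∈ regionR₁ a₁ a₂ a₃ ∪ regionR₂ a₁ a₂ a₃
          · rw [Set.indicator_of_mem hm, ENNReal.ofReal_of_nonpos]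
            exact mul_nonpos_of_nonneg_of_nonpos (by positivity) (not_lt.1 hx)
          · rw [Set.indicator_of_notMem hm, ENNReal.ofReal_zero]
      · intro r s hs
        rw [Set.indicator_of_notMem, ENNReal.ofReal_zero]
        exact fun h => hs.not_ge (sq_le_of_mem_momentTriangle h₁₂ h₂₃ h)
  refine ⟨?_, hii, hmU.aemeasurable, ?_, fun x => ?_, ?_⟩
  · rw [regionD₁_union_regionD₂ h₁₂ h₂₃]
    exact hi
  · exact (measurable_id.const_mul _).mul
      (((measurable_chiEps _ _).sub (measurable_chiEps _ _)).sub (measurable_chiEps _ _))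
  · rcases lt_trichotomy x 0 with hx | rfl | hx
    · simp [chiEps_of_neg hx]
    · simp
    · have := (chiEps_add_le_and_volume_slice h₁₂ h₂₃ hx).1
      exact mul_nonneg (by positivity) (by linarith)
  · have hcomp : (haarState 3).map (fun ψ => uncertainty A ψ)
        = ((haarState 3).map fun ψ => (expectation A ψ, uncertainty A ψ)).map Prod.snd := by
      rw [Measure.map_map measurable_snd (hmE.prodMk hmU)]
      rfl
    rw [hcomp, hii.2.2.2, map_snd_withDensity hii.2.1.ennreal_ofReal]
    congr 1
    ext x : 1
    have hslice : ∀ r, ENNReal.ofReal ((regionR₁ a₁ a₂ a₃ ∪ regionR₂ a₁ a₂ a₃).indicator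
        (fun p => 4 / V3 a₁ a₂ a₃ * p.2) (r, x))
        = {r | (r, x) ∈ regionR₁ a₁ a₂ a₃ ∪ regionR₂ a₁ a₂ a₃}.indicator
          (fun _ => ENNReal.ofReal (4 / V3 a₁ a₂ a₃ * x)) r := fun r => by
      by_cases hm : (r, x) ∈ regionR₁ a₁ a₂ a₃ ∪ regionR₂ a₁ a₂ a₃
      · rw [Set.indicator_of_mem hm, Set.indicator_of_mem (by exact hm)]
      · rw [Set.indicator_of_notMem hm, Set.indicator_of_notMem (by exact hm), ENNReal.ofReal_zero]
    have hms : MeasurableSet {r | (r, x) ∈ regionR₁ a₁ a₂ a₃ ∪ regionR₂ a₁ a₂ a₃} :=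
      (by fun_prop : Measurable fun r : ℝ => (r, x)) hR
    simp only [hslice]
    rw [lintegral_indicator hms, setLIntegral_const]
    -- For `x < 0` both densities vanish: `ENNReal.ofReal` truncates on the left, and every `chiEps`
    -- is 0 on the right.
    rcases lt_trichotomy x 0 with hx | rfl | hx
    · rw [ENNReal.ofReal_of_nonpos (mul_nonpos_of_nonneg_of_nonpos (by positivity) hx.le)]
      simp [chiEps_of_neg hx]
    · simp
    · rw [(chiEps_add_le_and_volume_slice h₁₂ h₂₃ hx).2, ← ENNReal.ofReal_mul (by positivity)]
      ring_nf
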